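/- Let $m\ge 2$, let $H_1,\dots,H_m$ be bounded self-adjoint operators on a complex Hilbert space (for instance Hermitian matrices), ordered by operator norm, $\|H_1\|\ge\|H_2\|\ge\cdots\ge\|H_m\|$, let $t$ be real, and let $0<\varepsilon\le 1$ be such that $4emt\|H_2\|\ge\varepsilon$ (here $e$ is Euler's number). For $\Delta\in\mathbb R$ define Suzuki's splitting formulas by $$S_2(\Delta)=e^{-iH_1\Delta/2}\cdots e^{-iH_m\Delta/2}\,e^{-iH_m\Delta/2}\cdots e^{-iH_1\Delta/2},$$ $$S_{2k}(\Delta)=[S_{2k-2}(p_k\Delta)]^2\,S_{2k-2}((1-4p_k)\Delta)\,[S_{2k-2}(p_k\Delta)]^2,\qquad p_k=(4-4^{1/(2k-1)})^{-1},\quad k\ge 2.$$ For $k\ge1$ let $N=N(k)$ be the number of exponentials that the $k$-th formula needs to simulate $e^{-i(H_1+\cdots+H_m)t}$ with accuracy $\varepsilon$: the least number of factors in a product $[S_{2k}(t/n)]^n$, $n\ge1$ an integer, with $\|e^{-i(H_1+\cdots+H_m)t}-[S_{2k}(t/n)]^n\|\le\varepsilon$, where neighbouring exponentials of the same $H_j$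 are combined and counted as one factor. Assume in addition that at least one of the following two conditions holds: (a) $4emt\|H_1\|\ge 3$; (b) $\displaystyle\Bigl(\ln\frac{4emt\|H_1\|}{5}\Bigr)^2-2\,\ln\frac53\,\ln\frac{4emt\|H_2\|}{\varepsilon}<0$. Then for every integer $k\ge 1$ the number $N(k)$ exists (the accuracy $\varepsilon$ is attained for some $n$) and $$N(k)\le 2(2m-1)\,5^{k-1}\,\|H_1\|\,t\left(\frac{4emt\|H_2\|}{\varepsilon}\right)^{1/(2k)}\frac{4me}{3}\left(\frac53\right)^{k-1}.$$ -/

import Mathlib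

namespace HamiltonianSimulation

/-- A finite product of exponentials of the form `e^{-i H_{j₁} τ₁} ⋯ e^{-i H_{j_N} τ_N}`, given by the
list of the pairs `(j_l, τ_l)`, from the leftmost factor to the rightmost one. The number of its
exponentials is the length of the list. -/
abbrev Splitting (m : ℕ) : Type := List (Fin m × ℝ)

/-- The operator `e^{-i H_{j₁} τ₁} ⋯ e^{-i H_{j_N} τ_N}`. -/
noncomputable def Splitting.toOperator {E : Type*} [NormedAddCommGroup E] [InnerProductSpace ℂ E]
    {m : ℕ} (H : Fin m → E →L[ℂ] E) (L : Splitting m) : E →L[ℂ] E :=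
  (L.map fun x => NormedSpace.exp ((-(Complex.I * (x.2 : ℂ))) • H x.1)).prod

/-- Multiply a product from the left by one more exponential, using
`e^{-i H_j a} e^{-i H_j b} = e^{-i H_j (a + b)}` when the new factor and the leftmost old factor
belong to the same Hamiltonian. -/
def Splitting.consMerge {m : ℕ} (x : Fin m × ℝ) : Splitting m → Splitting m
  | [] => [x]
  | y :: L => if x.1 = y.1 then (x.1, x.2 + y.2) :: L else x :: y :: L

/-- The product in which all neighbouring exponentials of the same Hamiltonian have been combined
into one. -/
def Splitting.merge {m : ℕ} (L : Splitting m) : Splitting m :=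
  L.foldr Splitting.consMerge []

/-- The symmetric second order formula
`S_2(Δ) = e^{-i H_1 Δ/2} ⋯ e^{-i H_m Δ/2} e^{-i H_m Δ/2} ⋯ e^{-i H_1 Δ/2}`. -/
noncomputable def strang (m : ℕ) (Δ : ℝ) : Splitting m :=
  (List.finRange m).map (fun j => (j, Δ / 2)) ++
    (List.finRange m).reverse.map (fun j => (j, Δ / 2))

/-- `p_k = (4 - 4^{1/(2k-1)})⁻¹`, used for `k ≥ 2`. -/
noncomputable def suzukiCoeff (k : ℕ) : ℝ :=
  (4 - (4 : ℝ) ^ (1 / (2 * (k : ℝ) - 1)))⁻¹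

/-- Suzuki's recursive formula `S_{2k}(Δ)` for `k ≥ 1`:
`S_{2k}(Δ) = S_{2k-2}(p_k Δ)² S_{2k-2}((1 - 4 p_k) Δ) S_{2k-2}(p_k Δ)²` for `k ≥ 2`.
(The value at `k = 0` is not used.) -/
noncomputable def suzuki (m : ℕ) : ℕ → ℝ → Splitting m
  | 0, _ => []
  | 1, Δ => strang m Δ
  | k + 2, Δ =>
      let p := suzukiCoeff (k + 2)
      suzuki m (k + 1) (p * Δ) ++ suzuki m (k + 1) (p * Δ) ++
        suzuki m (k + 1) ((1 - 4 * p) * Δ) ++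
        suzuki m (k + 1) (p * Δ) ++ suzuki m (k + 1) (p * Δ)

/-- The product `S_{2k}(t/n)^n` that arises when the time interval is divided into `n` equal
subintervals, with neighbouring exponentials of the same Hamiltonian combined. -/
noncomputable def splittingMethod (m k n : ℕ) (t : ℝ) : Splitting m :=
  Splitting.merge (List.replicate n (suzuki m k (t / (n : ℝ)))).flatten

/-- The numbers `N` for which the splitting method of order `2k + 1`, with some number `n ≥ 1` of
equal subintervals, consists of exactly `N` exponentials and approximates
`e^{-i (H_1 + ⋯ + H_m) t}` with error at most `ε` in the operator norm. -/
def achievableCounts {E : Type*} [NormedAddCommGroup E] [InnerProductSpace ℂ E]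
    {m : ℕ} (H : Fin m → E →L[ℂ] E) (t ε : ℝ) (k : ℕ) : Set ℕ :=
  {N | ∃ n : ℕ, 1 ≤ n ∧ (splittingMethod m k n t).length = N ∧
    ‖NormedSpace.exp ((-(Complex.I * (t : ℂ))) • ∑ j, H j) -
      (splittingMethod m k n t).toOperator H‖ ≤ ε}

/-- `N` is the number of exponentials that the splitting method of order `2k + 1` needs for the
simulation of `e^{-i (H_1 + ⋯ + H_m) t}` with accuracy `ε`. -/
def IsNumExponentials {E : Type*} [NormedAddCommGroup E] [InnerProductSpace ℂ E]
    {m : ℕ} (H : Fin m → E →L[ℂ] E) (t ε : ℝ) (k N : ℕ) : Prop :=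
  IsLeast (achievableCounts H t ε k) N

end HamiltonianSimulation

/-! Extended to complex time z, the error f(z) = S_{2k}(z) - e^{-i(H_1+⋯+H_m)z} is entire and
vanishes at 0 to order at least 2k+1 (`agreesTo_suzuki`): the choice of p_k cancels one leading
coefficient, and time symmetry cancels the next. On a disc, f has a bound proportional to ‖H_2‖
(`norm_evolve_suzuki_sub_le`), obtained by comparison with the system in which only H_1 is kept,
where Suzuki's formula is exact. A higher-order Schwarz lemma combines the two facts into the error
of one step (`norm_evolve_suzuki_sub_le_pow`), without expanding any commutators. The coefficients
p_k enter only through the growth of the absolute times, at most k(5/3)^{k-1} (`suzukiGrowth_le`).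

At real times all factors are unitary, so the errors of n steps add up. With Y = 4emt‖H_2‖/ε and M =
(4emt‖H_1‖/3) Y^{1/(2k)} (5/3)^{k-1}, any n ≥ M gives accuracy ε
(`norm_exp_sub_splittingMethod_le`). Each of (a) and (b) forces M ≥ 1 for every k (`one_le_steps`),
so n = ⌈M⌉ ≤ 2M, and each step costs at most (2m-1)5^{k-1} exponentials. -/

namespace HamiltonianSimulation

open Filter Topology

/-! ### Orders of vanishing at 0 and their leading coefficients -/

section Order

variable {A : Type*} [NormedRing A] [NormedAlgebra ℂ A]

/-- Near `0` the function `f` is `z ^ n • g z` with `g` analytic and `g 0 = c`. -/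
def HasLeadingCoeff (n : ℕ) (f : ℂ → A) (c : A) : Prop :=
  ∃ g : ℂ → A, AnalyticAt ℂ g 0 ∧ g 0 = c ∧ ∀ᶠ z in 𝓝 (0 : ℂ), f z = z ^ n • g z

theorem HasLeadingCoeff.congr {n : ℕ} {f f' : ℂ → A} {c : A} (h : HasLeadingCoeff n f c)
    (hf : ∀ z, f' z = f z) : HasLeadingCoeff n f' c := by
  rwa [show f' = f from funext hf]

theorem HasLeadingCoeff.add {n : ℕ} {f f' : ℂ → A} {c c' : A} (h : HasLeadingCoeff n f c)
    (h' : HasLeadingCoeff n f' c') : HasLeadingCoeff n (fun z => f z + f' z) (c + c') := by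
  obtain ⟨g, hg, rfl, hfg⟩ := h
  obtain ⟨g', hg', rfl, hfg'⟩ := h'
  refine ⟨fun z => g z + g' z, hg.add hg', rfl, ?_⟩
  filter_upwards [hfg, hfg'] with z h1 h2
  rw [h1, h2, smul_add]

theorem HasLeadingCoeff.neg {n : ℕ} {f : ℂ → A} {c : A} (h : HasLeadingCoeff n f c) :
    HasLeadingCoeff n (fun z => -f z) (-c) := by
  obtain ⟨g, hg, rfl, hfg⟩ := h
  refine ⟨fun z => -g z, hg.neg, rfl, ?_⟩
  filter_upwards [hfg] with z h1
  rw [h1, smul_neg]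

theorem HasLeadingCoeff.mul_right {n : ℕ} {f u : ℂ → A} {c : A} (h : HasLeadingCoeff n f c)
    (hu : AnalyticAt ℂ u 0) : HasLeadingCoeff n (fun z => f z * u z) (c * u 0) := by
  obtain ⟨g, hg, rfl, hfg⟩ := h
  refine ⟨fun z => g z * u z, hg.mul hu, rfl, ?_⟩
  filter_upwards [hfg] with z h1
  rw [h1, smul_mul_assoc]

theorem HasLeadingCoeff.mul_left {n : ℕ} {f u : ℂ → A} {c : A} (h : HasLeadingCoeff n f c)
    (hu : AnalyticAt ℂ u 0) : HasLeadingCoeff n (fun z => u z * f z) (u 0 * c) := by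
  obtain ⟨g, hg, rfl, hfg⟩ := h
  refine ⟨fun z => u z * g z, hu.mul hg, rfl, ?_⟩
  filter_upwards [hfg] with z h1
  rw [h1, mul_smul_comm]

theorem HasLeadingCoeff.comp_mul {n : ℕ} {f : ℂ → A} {c : A} (h : HasLeadingCoeff n f c) (a : ℂ) :
    HasLeadingCoeff n (fun z => f (a * z)) (a ^ n • c) := by
  obtain ⟨g, hg, rfl, hfg⟩ := h
  have ha : Tendsto (fun z : ℂ => a * z) (𝓝 0) (𝓝 0) := by
    simpa using (continuous_const_mul a).tendsto (0 : ℂ)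
  refine ⟨fun z => a ^ n • g (a * z), ?_, by simp, ?_⟩
  · have : AnalyticAt ℂ g (a * 0) := by simpa using hg
    have := this.comp (f := fun z : ℂ => a * z) (by fun_prop)
    exact (analyticAt_const (𝕜 := ℂ) (v := a ^ n)).smul this
  · filter_upwards [ha.eventually hfg] with z h1
    rw [h1, mul_pow, mul_comm, mul_smul]

theorem HasLeadingCoeff.succ {n : ℕ} {f : ℂ → A} (h : HasLeadingCoeff n f 0) :
    ∃ c, HasLeadingCoeff (n + 1) f c := by
  obtain ⟨g, hg, h0, hfg⟩ := h
  have h1 : (1 : ℕ) ≤ analyticOrderAt g 0 := by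
    rw [Nat.cast_one, Order.one_le_iff_ne_zero]
    exact hg.analyticOrderAt_ne_zero.2 h0
  obtain ⟨g', hg', hgg'⟩ := (natCast_le_analyticOrderAt hg).1 h1
  refine ⟨g' 0, g', hg', rfl, ?_⟩
  filter_upwards [hfg, hgg'] with z h1 h2
  rw [h1, h2, smul_smul, sub_zero, ← pow_add]

/-- Dividing by z ^ n shows that g vanishes on a punctured neighbourhood of 0, hence at 0 by
continuity. -/
theorem HasLeadingCoeff.eq_zero {n : ℕ} {f : ℂ → A} {c : A} (h : HasLeadingCoeff n f c)
    (hf : ∀ z, f z = 0) : c = 0 := by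
  obtain ⟨g, hg, rfl, hfg⟩ := h
  have h1 : Tendsto g (𝓝[≠] 0) (𝓝 (g 0)) := hg.continuousAt.tendsto.mono_left nhdsWithin_le_nhds
  refine tendsto_nhds_unique h1 (tendsto_const_nhds.congr' ?_)
  filter_upwards [hfg.filter_mono nhdsWithin_le_nhds, self_mem_nhdsWithin] with z hz hz0
  rw [hf z] at hz
  exact ((smul_eq_zero.1 hz.symm).resolve_left (pow_ne_zero _ hz0)).symm

theorem HasLeadingCoeff.isLittleO {n : ℕ} {f : ℂ → A} {c : A} (h : HasLeadingCoeff (n + 1) f c) :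
    f =o[𝓝 0] fun z => ‖z‖ ^ n := by
  obtain ⟨g, hg, rfl, hfg⟩ := h
  have h1 : g =O[𝓝 0] (fun _ => (1 : ℝ)) := hg.continuousAt.isBigO_one ℝ
  have h2 : (fun z : ℂ => z) =o[𝓝 0] (fun _ => (1 : ℝ)) :=
    (Asymptotics.isLittleO_one_iff ℝ).2 tendsto_id
  have h3 : (fun z : ℂ => z ^ n) =O[𝓝 0] (fun z => ‖z‖ ^ n) :=
    Asymptotics.isBigO_of_le _ fun z => by simp
  have h4 := (h3.smul_isLittleO (h2.smul_isBigO h1))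
  refine (h4.congr' ?_ (Eventually.of_forall fun z => ?_))
  · filter_upwards [hfg] with z hz
    rw [hz, smul_smul, pow_succ]
  · simp

/-- Two functions with value `1` at `0` whose difference has leading coefficient `c` at order `n`. -/
structure AgreesTo (n : ℕ) (u v : ℂ → A) (c : A) : Prop where
  left : AnalyticAt ℂ u 0
  right : AnalyticAt ℂ v 0
  left_zero : u 0 = 1
  right_zero : v 0 = 1
  sub : HasLeadingCoeff n (fun z => u z - v z) c

/-- Leading coefficients simply add because all the functions equal 1 at 0; no commutators appear at
this order. -/
theorem AgreesTo.mul {n : ℕ} {u v u' v' : ℂ → A} {c c' : A} (h : AgreesTo n u v c)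
    (h' : AgreesTo n u' v' c') :
    AgreesTo n (fun z => u z * u' z) (fun z => v z * v' z) (c + c') where
  left := h.left.mul h'.left
  right := h.right.mul h'.right
  left_zero := by rw [h.left_zero, h'.left_zero, one_mul]
  right_zero := by rw [h.right_zero, h'.right_zero, one_mul]
  sub := by
    have h1 := (h.sub.mul_right h'.left).add (h'.sub.mul_left h.right)
    rw [h'.left_zero, h.right_zero, mul_one, one_mul] at h1
    exact h1.congr fun z => by noncomm_ring

theorem AgreesTo.comp_mul {n : ℕ} {u v : ℂ → A} {c : A} (h : AgreesTo n u v c) (a : ℂ) :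
    AgreesTo n (fun z => u (a * z)) (fun z => v (a * z)) (a ^ n • c) where
  left := by
    have : AnalyticAt ℂ u (a * 0) := by simpa using h.left
    exact this.comp (f := fun z : ℂ => a * z) (by fun_prop)
  right := by
    have : AnalyticAt ℂ v (a * 0) := by simpa using h.right
    exact this.comp (f := fun z : ℂ => a * z) (by fun_prop)
  left_zero := by simp [h.left_zero]
  right_zero := by simp [h.right_zero]
  sub := h.sub.comp_mul a

theorem AgreesTo.succ {n : ℕ} {u v : ℂ → A} (h : AgreesTo n u v 0) :
    ∃ c, AgreesTo (n + 1) u v c := by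
  obtain ⟨c, hc⟩ := h.sub.succ
  exact ⟨c, h.left, h.right, h.left_zero, h.right_zero, hc⟩

/-- For two time-symmetric functions, the order of agreement is odd. -/
theorem AgreesTo.succ_of_symmetric {n : ℕ} (hn : Even n) {u v : ℂ → A} {c : A}
    (h : AgreesTo n u v c) (hu : ∀ z, u z * u (-z) = 1) (hv : ∀ z, v z * v (-z) = 1) :
    ∃ c, AgreesTo (n + 1) u v c := by
  -- u(z)u(-z) and v(z)v(-z) are both 1, so the coefficient c + (-1)^n c of their difference
  -- vanishes; for even n it is 2c.
  have h1 := (h.mul (h.comp_mul (-1))).sub.eq_zero fun z => by simp [hu, hv]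
  rw [hn.neg_one_pow, one_smul, ← two_smul ℂ c] at h1
  obtain rfl : c = 0 := (smul_eq_zero.1 h1).resolve_left two_ne_zero
  exact h.succ

/-- Suzuki's fractal composition raises the order of agreement by one. -/
theorem AgreesTo.suzuki_step {n : ℕ} {u v : ℂ → A} {c : A} (h : AgreesTo n u v c) {p : ℂ}
    (hp : 4 * p ^ n + (1 - 4 * p) ^ n = 0)
    (hv : ∀ a b, v (a + b) = v a * v b) :
    ∃ c, AgreesTo (n + 1) (fun z => u (p * z) * u (p * z) * u ((1 - 4 * p) * z) *
      u (p * z) * u (p * z)) v c := by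
  have hq := h.comp_mul p
  have h1 := (((hq.mul hq).mul (h.comp_mul (1 - 4 * p))).mul hq).mul hq
  have h2 : p ^ n • c + p ^ n • c + (1 - 4 * p) ^ n • c + p ^ n • c + p ^ n • c = 0 := by
    simp only [← add_smul]
    rw [← zero_smul ℂ c, ← hp]
    congr 1
    ring
  have h3 : (fun z => v (p * z) * v (p * z) * v ((1 - 4 * p) * z) * v (p * z) * v (p * z)) = v := by
    funext z
    simp only [← hv]
    congr 1
    ring
  rw [h2, h3] at h1
  exact h1.succ

end Order

/-! ### Splittings at complex times and the order condition -/

section Evolve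

variable {A : Type*} [NormedRing A] [NormedAlgebra ℂ A] {m : ℕ}

/-- The product `e^{-i H_{j₁} τ₁ z} ⋯ e^{-i H_{j_N} τ_N z}` for a complex time `z`. -/
noncomputable def evolve (H : Fin m → A) (L : Splitting m) (z : ℂ) : A :=
  (L.map fun x => NormedSpace.exp ((-(Complex.I * ((x.2 : ℂ) * z))) • H x.1)).prod

theorem evolve_nil (H : Fin m → A) (z : ℂ) : evolve H [] z = 1 := rfl

theorem evolve_cons (H : Fin m → A) (x : Fin m × ℝ) (L : Splitting m) (z : ℂ) :
    evolve H (x :: L) z =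
      NormedSpace.exp ((-(Complex.I * ((x.2 : ℂ) * z))) • H x.1) * evolve H L z := by
  simp [evolve]

theorem evolve_append (H : Fin m → A) (L L' : Splitting m) (z : ℂ) :
    evolve H (L ++ L') z = evolve H L z * evolve H L' z := by
  simp [evolve]

theorem evolve_zero (H : Fin m → A) (L : Splitting m) : evolve H L 0 = 1 := by
  simp [evolve]

/-- The splitting with all times multiplied by `a`. -/
def Splitting.scale (a : ℝ) (L : Splitting m) : Splitting m := L.map fun x => (x.1, a * x.2)

theorem Splitting.scale_append (a : ℝ) (L L' : Splitting m) :
    Splitting.scale a (L ++ L') = L.scale a ++ L'.scale a := by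
  simp [Splitting.scale]

theorem Splitting.scale_scale (a b : ℝ) (L : Splitting m) :
    (L.scale b).scale a = L.scale (a * b) := by
  simp [Splitting.scale, mul_assoc]

theorem evolve_scale (H : Fin m → A) (a : ℝ) (L : Splitting m) (z : ℂ) :
    evolve H (L.scale a) z = evolve H L (a * z) := by
  simp only [evolve, Splitting.scale, List.map_map]
  congr 2
  funext x
  simp only [Function.comp, Complex.ofReal_mul]
  congr 2
  ring

theorem suzuki_add_two (m k : ℕ) (Δ : ℝ) : suzuki m (k + 2) Δ =
    suzuki m (k + 1) (suzukiCoeff (k + 2) * Δ) ++ suzuki m (k + 1) (suzukiCoeff (k + 2) * Δ) ++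
      suzuki m (k + 1) ((1 - 4 * suzukiCoeff (k + 2)) * Δ) ++
      suzuki m (k + 1) (suzukiCoeff (k + 2) * Δ) ++ suzuki m (k + 1) (suzukiCoeff (k + 2) * Δ) :=
  rfl

theorem strang_eq_scale (m : ℕ) (Δ : ℝ) : strang m Δ = (strang m 1).scale Δ := by
  simp [strang, Splitting.scale, div_eq_mul_inv, Function.comp_def]

theorem suzuki_eq_scale (m k : ℕ) (Δ : ℝ) :
    suzuki m (k + 1) Δ = (suzuki m (k + 1) 1).scale Δ := by
  induction k generalizing Δ with
  | zero => exact strang_eq_scale m Δ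
  | succ k ih =>
    rw [suzuki_add_two, suzuki_add_two, ih, ih ((1 - 4 * suzukiCoeff (k + 2)) * Δ),
      ih (suzukiCoeff (k + 2) * 1), ih ((1 - 4 * suzukiCoeff (k + 2)) * 1)]
    simp only [Splitting.scale_append, Splitting.scale_scale]
    simp only [mul_one, one_mul, mul_comm]

theorem reverse_suzuki (m k : ℕ) (Δ : ℝ) :
    (suzuki m (k + 1) Δ).reverse = suzuki m (k + 1) Δ := by
  induction k generalizing Δ with
  | zero => simp [suzuki, strang]
  | succ k ih => simp [suzuki_add_two, ih]

theorem evolve_suzuki_add_two (H : Fin m → A) (k : ℕ) (z : ℂ) :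
    evolve H (suzuki m (k + 2) 1) z =
      evolve H (suzuki m (k + 1) 1) (suzukiCoeff (k + 2) * z) *
      evolve H (suzuki m (k + 1) 1) (suzukiCoeff (k + 2) * z) *
      evolve H (suzuki m (k + 1) 1) ((1 - 4 * suzukiCoeff (k + 2)) * z) *
      evolve H (suzuki m (k + 1) 1) (suzukiCoeff (k + 2) * z) *
      evolve H (suzuki m (k + 1) 1) (suzukiCoeff (k + 2) * z) := by
  rw [suzuki_add_two, suzuki_eq_scale m k (suzukiCoeff (k + 2) * 1),
    suzuki_eq_scale m k ((1 - 4 * suzukiCoeff (k + 2)) * 1)]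
  simp only [evolve_append, evolve_scale]
  push_cast
  simp

/-- The exact evolution `e^{-i (∑ H_j) z}`. -/
noncomputable def exactEvolution (H : Fin m → A) (z : ℂ) : A :=
  NormedSpace.exp ((-(Complex.I * z)) • ∑ j, H j)

theorem exactEvolution_zero (H : Fin m → A) : exactEvolution H 0 = 1 := by
  simp [exactEvolution]

variable [CompleteSpace A]

theorem exp_add_smul (a b : ℂ) (B : A) :
    NormedSpace.exp ((a + b) • B) = NormedSpace.exp (a • B) * NormedSpace.exp (b • B) := by
  let _ := NormedAlgebra.restrictScalars ℚ ℂ A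
  rw [add_smul]
  exact NormedSpace.exp_add_of_commute (((Commute.refl B).smul_left a).smul_right b)

/-- The factors cancel in pairs from the middle outwards. For the palindromes of `reverse_suzuki`
this is time symmetry. -/
theorem evolve_mul_evolve_reverse_neg (H : Fin m → A) (L : Splitting m) (z : ℂ) :
    evolve H L z * evolve H L.reverse (-z) = 1 := by
  induction L with
  | nil => simp [evolve]
  | cons x L ih =>
    rw [List.reverse_cons, evolve_append, evolve_cons, mul_assoc, ← mul_assoc (evolve H L z), ih,
      one_mul, evolve_cons, evolve_nil, mul_one, ← exp_add_smul]
    simp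

theorem differentiable_evolve (H : Fin m → A) (L : Splitting m) :
    Differentiable ℂ (evolve H L) := by
  induction L with
  | nil => exact differentiable_const (1 : A)
  | cons x L ih =>
    have h1 : Differentiable ℂ fun z : ℂ =>
        NormedSpace.exp ((-(Complex.I * ((x.2 : ℂ) * z))) • H x.1) :=
      (differentiable_exp_smul_const ℂ (H x.1)).comp (by fun_prop)
    have h2 := h1.mul ih
    have : evolve H (x :: L) = fun z =>
        NormedSpace.exp ((-(Complex.I * ((x.2 : ℂ) * z))) • H x.1) * evolve H L z :=
      funext (evolve_cons H x L)
    rw [this]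
    exact h2

theorem agreesTo_exp (B : A) (a : ℂ) :
    AgreesTo 1 (fun z : ℂ => NormedSpace.exp ((-(Complex.I * (a * z))) • B)) (fun _ => 1)
      ((-(Complex.I * a)) • B) where
  left := (((differentiable_exp_smul_const ℂ B).comp
    (f := fun z : ℂ => -(Complex.I * (a * z))) (by fun_prop)).analyticAt 0)
  right := analyticAt_const
  left_zero := by simp
  right_zero := rfl
  sub := by
    have h1 : AgreesTo 0 (fun z : ℂ => NormedSpace.exp (z • B)) (fun _ => 1) 0 :=
      ⟨(differentiable_exp_smul_const ℂ B).analyticAt 0, analyticAt_const, by simp, rfl,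
        fun z => NormedSpace.exp (z • B) - 1,
        ((differentiable_exp_smul_const ℂ B).sub_const 1).analyticAt 0, by simp, by simp⟩
    obtain ⟨c, h2⟩ := h1.sub.succ
    -- The leading coefficient is the derivative at 0, which is unique.
    have hc : c = B := by
      obtain ⟨g, hg, rfl, hfg⟩ := h2
      have h3 : HasDerivAt (fun z : ℂ => NormedSpace.exp (z • B)) B 0 := by
        simpa using hasDerivAt_exp_smul_const B (0 : ℂ)
      have h4 : HasDerivAt (fun z : ℂ => z • g z + 1) (g 0) 0 := by
        simpa using ((hasDerivAt_id (0 : ℂ)).smul hg.differentiableAt.hasDerivAt).add_const (1 : A)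
      refine h4.unique (h3.congr_of_eventuallyEq ?_)
      filter_upwards [hfg] with z hz
      rw [zero_add, pow_one] at hz
      rw [← hz, sub_add_cancel]
    rw [hc] at h2
    have h3 := h2.comp_mul (-(Complex.I * a))
    rw [zero_add, pow_one] at h3
    exact h3.congr fun z => by simp only [neg_mul, mul_assoc]

theorem agreesTo_evolve (H : Fin m → A) (L : Splitting m) :
    AgreesTo 1 (evolve H L) (fun _ => 1)
      (L.map fun x => (-(Complex.I * (x.2 : ℂ))) • H x.1).sum := by
  induction L with
  | nil =>
    refine ⟨analyticAt_const, analyticAt_const, rfl, rfl, fun _ => 0, analyticAt_const, by simp, ?_⟩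
    exact Eventually.of_forall fun z => by simp [evolve]
  | cons x L ih =>
    have h := (agreesTo_exp (H x.1) (x.2 : ℂ)).mul ih
    rw [show (fun _ : ℂ => (1 : A) * 1) = fun _ => 1 by simp] at h
    rw [List.map_cons, List.sum_cons,
      show evolve H (x :: L) = _ from funext (evolve_cons H x L)]
    exact h

theorem sum_map_strang {M : Type*} [AddCommMonoid M] (m : ℕ) (Δ : ℝ) (f : Fin m × ℝ → M) :
    ((strang m Δ).map f).sum = ∑ j, (f (j, Δ / 2) + f (j, Δ / 2)) := by
  rw [Finset.sum_add_distrib]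
  simp only [strang, List.map_append, List.sum_append, List.map_map, List.map_reverse,
    List.sum_reverse]
  rw [← List.ofFn_eq_map, List.sum_ofFn]
  rfl

theorem differentiable_exactEvolution (H : Fin m → A) : Differentiable ℂ (exactEvolution H) :=
  (differentiable_exp_smul_const ℂ (∑ j, H j)).comp (f := fun z : ℂ => -(Complex.I * z))
    (by fun_prop)

theorem exactEvolution_add (H : Fin m → A) (a b : ℂ) :
    exactEvolution H (a + b) = exactEvolution H a * exactEvolution H b := by
  rw [exactEvolution, mul_add, neg_add, exp_add_smul]
  rfl

theorem agreesTo_strang (H : Fin m → A) :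
    ∃ c, AgreesTo 3 (evolve H (strang m 1)) (exactEvolution H) c := by
  have h1 := agreesTo_evolve H (strang m 1)
  have h2 := agreesTo_exp (∑ j, H j) (1 : ℂ)
  have h3 : AgreesTo 1 (evolve H (strang m 1)) (exactEvolution H) 0 := by
    refine ⟨h1.left, (differentiable_exactEvolution H).analyticAt 0, h1.left_zero,
      exactEvolution_zero H, ?_⟩
    have h4 := h1.sub.add h2.sub.neg
    have h5 : ((strang m 1).map fun x => (-(Complex.I * (x.2 : ℂ))) • H x.1).sum +
        -((-(Complex.I * 1)) • ∑ j, H j) = 0 := by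
      rw [sum_map_strang, Finset.smul_sum, ← sub_eq_add_neg, ← Finset.sum_sub_distrib]
      refine Finset.sum_eq_zero fun j _ => ?_
      rw [← add_smul, ← sub_smul]
      push_cast
      rw [show -(Complex.I * (1 / 2)) + -(Complex.I * (1 / 2)) - -(Complex.I * 1) = 0 by ring,
        zero_smul]
    rw [h5] at h4
    exact h4.congr fun z => by simp [exactEvolution]
  obtain ⟨c, h4⟩ := h3.succ
  refine h4.succ_of_symmetric even_two (fun z => ?_) fun z => ?_
  · have := evolve_mul_evolve_reverse_neg H (strang m 1) z
    rwa [show (strang m 1).reverse = strang m 1 from reverse_suzuki m 0 1] at this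
  · rw [← exactEvolution_add, add_neg_cancel, exactEvolution_zero]

/-- With s = 1/(2k+3), Bernoulli's inequality gives 4^s ≤ 1 + 3s, hence p ≤ 1/(3 - 3s). The factor
(k+2)/(k+1) is shaped to telescope in `suzukiGrowth_le`. The last identity is the order condition: 1
- 4p = -4^s p, the exponent is odd, and 4^{s(2k+3)} = 4. -/
theorem suzukiCoeff_bounds (k : ℕ) :
    1 / 4 ≤ suzukiCoeff (k + 2) ∧ 8 * suzukiCoeff (k + 2) - 1 ≤ 5 / 3 * ((k + 2) / (k + 1)) ∧
      4 * suzukiCoeff (k + 2) ^ (2 * k + 3) + (1 - 4 * suzukiCoeff (k + 2)) ^ (2 * k + 3) = 0 := by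
  set s : ℝ := 1 / (2 * ((k + 2 : ℕ) : ℝ) - 1) with hs
  have hk : (0 : ℝ) ≤ k := Nat.cast_nonneg k
  have hs' : s = 1 / (2 * k + 3) := by
    rw [hs]; push_cast; congr 1; ring
  have hs0 : 0 < s := by rw [hs']; positivity
  have hs1 : s < 1 := by rw [hs', div_lt_one (by positivity)]; linarith
  have h4 : (4 : ℝ) ^ s ≤ 1 + s * 3 := by
    have := rpow_one_add_le_one_add_mul_self (s := 3) (by norm_num) hs0.le hs1.le
    norm_num at this
    exact this
  have hpos : (0 : ℝ) < 4 ^ s := by positivity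
  have hp : suzukiCoeff (k + 2) = (4 - 4 ^ s)⁻¹ := rfl
  have hden : 0 < 4 - (4 : ℝ) ^ s := by linarith
  have hpow : ((4 : ℝ) ^ s) ^ (2 * k + 3) = 4 := by
    rw [← Real.rpow_natCast, ← Real.rpow_mul (by norm_num), hs']
    push_cast
    rw [one_div, inv_mul_cancel₀ (by positivity), Real.rpow_one]
  refine ⟨?_, ?_, ?_⟩
  · rw [hp, one_div]
    exact inv_anti₀ hden (by linarith)
  · have h5 : suzukiCoeff (k + 2) ≤ (3 - s * 3)⁻¹ := by
      rw [hp]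
      exact inv_anti₀ (by linarith) (by linarith)
    have h6 : (3 - s * 3)⁻¹ = (2 * k + 3) / (6 * (k + 1)) := by
      rw [hs', inv_eq_one_div, div_eq_div_iff (by rw [← hs']; linarith) (by positivity)]
      field_simp
      ring
    rw [h6] at h5
    have h7 : 8 * ((2 * k + 3) / (6 * (k + 1))) - 1 ≤ 5 / 3 * (((k : ℝ) + 2) / (k + 1)) := by
      rw [← sub_nonneg]
      have : 5 / 3 * (((k : ℝ) + 2) / (k + 1)) - (8 * ((2 * k + 3) / (6 * (k + 1))) - 1) =
          1 / (3 * (k + 1)) := by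
        field_simp
        ring
      rw [this]
      positivity
    linarith
  · have h5 : 1 - 4 * suzukiCoeff (k + 2) = -((4 : ℝ) ^ s * suzukiCoeff (k + 2)) := by
      rw [hp]
      field_simp
      ring
    have hodd : Odd (2 * k + 3) := ⟨k + 1, by ring⟩
    rw [h5, hodd.neg_pow, mul_pow, hpow]
    ring

/-- The order condition: Suzuki's formula agrees with the exact evolution up to order `2k`. -/
theorem agreesTo_suzuki (H : Fin m → A) (k : ℕ) :
    ∃ c, AgreesTo (2 * k + 3) (evolve H (suzuki m (k + 1) 1)) (exactEvolution H) c := by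
  induction k with
  | zero => exact agreesTo_strang H
  | succ k ih =>
    obtain ⟨c, hc⟩ := ih
    have hp := (suzukiCoeff_bounds k).2.2
    obtain ⟨c', hc'⟩ := hc.suzuki_step (p := (suzukiCoeff (k + 2) : ℂ)) (by exact_mod_cast hp)
      (exactEvolution_add H)
    rw [← show evolve H (suzuki m (k + 2) 1) = _ from funext (evolve_suzuki_add_two H k)] at hc'
    refine hc'.succ_of_symmetric ⟨k + 2, by ring⟩ (fun z => ?_) fun z => ?_
    · have := evolve_mul_evolve_reverse_neg H (suzuki m (k + 2) 1) z
      rwa [reverse_suzuki m (k + 1) 1] at this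
    · rw [← exactEvolution_add, add_neg_cancel, exactEvolution_zero]

end Evolve

/-! ### Scalar majorants for differences of evolutions -/

section Majorant

variable {A : Type*} [NormedRing A]

/-- The norms of `a`, `b` and `a - b` are at most `F`, `G` and `F - G`. -/
structure Majorizes (a b : A) (F G : ℝ) : Prop where
  left : ‖a‖ ≤ F
  right : ‖b‖ ≤ G
  sub : ‖a - b‖ ≤ F - G

/-- The same telescoping identity splits aa' - bb' and FF' - GG'. Keeping the difference F - G,
rather than F + G, is what later preserves the small factor ‖H_2‖. -/
theorem Majorizes.mul {a b a' b' : A} {F G F' G' : ℝ} (h : Majorizes a b F G)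
    (h' : Majorizes a' b' F' G') : Majorizes (a * a') (b * b') (F * F') (G * G') := by
  have hF := (norm_nonneg a).trans h.left
  have hG := (norm_nonneg b).trans h.right
  have hFG := (norm_nonneg _).trans h.sub
  refine ⟨(norm_mul_le _ _).trans (mul_le_mul h.left h'.left (norm_nonneg _) hF),
    (norm_mul_le _ _).trans (mul_le_mul h.right h'.right (norm_nonneg _) hG), ?_⟩
  calc ‖a * a' - b * b'‖ = ‖a * (a' - b') + (a - b) * b'‖ := by congr 1; noncomm_ring
    _ ≤ ‖a‖ * ‖a' - b'‖ + ‖a - b‖ * ‖b'‖ :=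
      (norm_add_le _ _).trans (add_le_add (norm_mul_le _ _) (norm_mul_le _ _))
    _ ≤ F * (F' - G') + (F - G) * G' :=
      add_le_add (mul_le_mul h.left h'.sub (norm_nonneg _) hF)
        (mul_le_mul h.sub h'.right (norm_nonneg _) hFG)
    _ = F * F' - G * G' := by ring

theorem Majorizes.add {a b a' b' : A} {F G F' G' : ℝ} (h : Majorizes a b F G)
    (h' : Majorizes a' b' F' G') : Majorizes (a + a') (b + b') (F + F') (G + G') := by
  refine ⟨(norm_add_le _ _).trans (add_le_add h.left h'.left),
    (norm_add_le _ _).trans (add_le_add h.right h'.right), ?_⟩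
  rw [add_sub_add_comm, add_sub_add_comm]
  exact (norm_add_le _ _).trans (add_le_add h.sub h'.sub)

theorem Majorizes.smul [NormedAlgebra ℂ A] {a b : A} {F G : ℝ} (h : Majorizes a b F G) (c : ℂ) :
    Majorizes (c • a) (c • b) (‖c‖ * F) (‖c‖ * G) := by
  refine ⟨?_, ?_, ?_⟩
  · rw [norm_smul]; exact mul_le_mul_of_nonneg_left h.left (norm_nonneg c)
  · rw [norm_smul]; exact mul_le_mul_of_nonneg_left h.right (norm_nonneg c)
  · rw [← smul_sub, norm_smul, ← mul_sub]; exact mul_le_mul_of_nonneg_left h.sub (norm_nonneg c)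

theorem Majorizes.sum {ι : Type*} (s : Finset ι) {a b : ι → A} {F G : ι → ℝ}
    (h : ∀ i, Majorizes (a i) (b i) (F i) (G i)) :
    Majorizes (∑ i ∈ s, a i) (∑ i ∈ s, b i) (∑ i ∈ s, F i) (∑ i ∈ s, G i) := by
  classical
  induction s using Finset.induction_on with
  | empty => exact ⟨by simp, by simp, by simp⟩
  | insert i s hi ih =>
    simp only [Finset.sum_insert hi]
    exact (h i).add ih

theorem Majorizes.one [NormOneClass A] : Majorizes (1 : A) 1 1 1 :=
  ⟨norm_one.le, norm_one.le, by simp⟩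

theorem Majorizes.pow [NormOneClass A] {a b : A} {F G : ℝ} (h : Majorizes a b F G) (n : ℕ) :
    Majorizes (a ^ n) (b ^ n) (F ^ n) (G ^ n) := by
  induction n with
  | zero => simpa using Majorizes.one
  | succ n ih =>
    simp only [pow_succ]
    exact ih.mul h

variable [NormedAlgebra ℂ A] [NormOneClass A] [CompleteSpace A]

/-- Termwise comparison of the power series, whose coefficients are nonnegative. -/
theorem Majorizes.exp {a b : A} {F G : ℝ} (h : Majorizes a b F G) :
    Majorizes (NormedSpace.exp a) (NormedSpace.exp b) (Real.exp F) (Real.exp G) := by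
  have hs (x : A) : HasSum (fun n : ℕ => ((n.factorial : ℂ)⁻¹) • x ^ n) (NormedSpace.exp x) :=
    NormedSpace.exp_series_hasSum_exp' x
  have hr (x : ℝ) : HasSum (fun n : ℕ => ((n.factorial : ℝ)⁻¹) * x ^ n) (Real.exp x) := by
    rw [Real.exp_eq_exp_ℝ]
    exact NormedSpace.exp_series_hasSum_exp' (𝕂 := ℝ) x
  have hn (n : ℕ) : ‖((n.factorial : ℂ)⁻¹)‖ = (n.factorial : ℝ)⁻¹ := by simp
  have ht (n : ℕ) := (h.pow n).smul ((n.factorial : ℂ)⁻¹)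
  simp only [hn] at ht
  exact ⟨(hs a).norm_le_of_bounded (hr F) fun n => (ht n).left,
    (hs b).norm_le_of_bounded (hr G) fun n => (ht n).right,
    ((hs a).sub (hs b)).norm_le_of_bounded ((hr F).sub (hr G)) fun n => (ht n).sub⟩

variable {m : ℕ}

/-- The sum of the terms `|τ| α_j` over the factors `e^{-i H_j τ}` of a splitting. -/
def Splitting.absWeight (α : Fin m → ℝ) (L : Splitting m) : ℝ :=
  (L.map fun x => |x.2| * α x.1).sum

theorem Splitting.absWeight_append (α : Fin m → ℝ) (L L' : Splitting m) :
    Splitting.absWeight α (L ++ L') = L.absWeight α + L'.absWeight α := by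
  simp [Splitting.absWeight]

theorem Majorizes.evolve {H H' : Fin m → A} {α β : Fin m → ℝ}
    (h : ∀ j, Majorizes (H j) (H' j) (α j) (β j)) (L : Splitting m) (z : ℂ) :
    Majorizes (evolve H L z) (evolve H' L z) (Real.exp (‖z‖ * L.absWeight α))
      (Real.exp (‖z‖ * L.absWeight β)) := by
  induction L with
  | nil => simpa [evolve_nil, Splitting.absWeight] using Majorizes.one
  | cons x L ih =>
    have h1 := ((h x.1).smul (-(Complex.I * ((x.2 : ℂ) * z)))).exp.mul ih
    rw [← evolve_cons, ← evolve_cons, ← Real.exp_add, ← Real.exp_add] at h1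
    convert h1 using 2
    · simp [Splitting.absWeight]; ring
    · simp [Splitting.absWeight]; ring

theorem Majorizes.exactEvolution {H H' : Fin m → A} {α β : Fin m → ℝ}
    (h : ∀ j, Majorizes (H j) (H' j) (α j) (β j)) (z : ℂ) :
    Majorizes (exactEvolution H z) (exactEvolution H' z) (Real.exp (‖z‖ * ∑ j, α j))
      (Real.exp (‖z‖ * ∑ j, β j)) := by
  simpa [HamiltonianSimulation.exactEvolution] using
    ((Majorizes.sum Finset.univ h).smul (-(Complex.I * z))).exp

end Majorant

/-- The factor by which the absolute times of `S_{2k+2}` exceed those of `S_2`. -/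
noncomputable def suzukiGrowth : ℕ → ℝ
  | 0 => 1
  | k + 1 => (8 * suzukiCoeff (k + 2) - 1) * suzukiGrowth k

theorem one_le_suzukiGrowth (k : ℕ) : 1 ≤ suzukiGrowth k := by
  induction k with
  | zero => exact le_rfl
  | succ k ih =>
    have := (suzukiCoeff_bounds k).1
    exact one_le_mul_of_one_le_of_one_le (by linarith) ih

theorem suzukiGrowth_le (k : ℕ) : suzukiGrowth k ≤ (k + 1) * (5 / 3) ^ k := by
  induction k with
  | zero => simp [suzukiGrowth]
  | succ k ih =>
    have h0 := (suzukiCoeff_bounds k).2.1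
    have h1 := one_le_suzukiGrowth k
    calc suzukiGrowth (k + 1) = (8 * suzukiCoeff (k + 2) - 1) * suzukiGrowth k := rfl
      _ ≤ (5 / 3 * ((k + 2) / (k + 1))) * ((k + 1) * (5 / 3) ^ k) :=
        mul_le_mul h0 ih (by linarith) (by positivity)
      _ = _ := by push_cast; field_simp; ring

/-- As p ≥ 1/4, the middle coefficient 1 - 4p is nonpositive, so the five absolute coefficients sum
to 4p + (4p - 1) = 8p - 1. -/
theorem absWeight_suzuki {m : ℕ} (α : Fin m → ℝ) (k : ℕ) (Δ : ℝ) :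
    (suzuki m (k + 1) Δ).absWeight α = |Δ| * (suzukiGrowth k * ∑ j, α j) := by
  induction k generalizing Δ with
  | zero =>
    change (strang m Δ).absWeight α = _
    rw [Splitting.absWeight, sum_map_strang, suzukiGrowth, one_mul, Finset.mul_sum]
    refine Finset.sum_congr rfl fun j _ => ?_
    rw [abs_div, abs_two]
    ring
  | succ k ih =>
    have h := (suzukiCoeff_bounds k).1
    simp only [suzuki_add_two, Splitting.absWeight_append, ih, suzukiGrowth, abs_mul]
    rw [abs_of_nonneg (by linarith : 0 ≤ suzukiCoeff (k + 2)),
      abs_of_nonpos (by linarith : 1 - 4 * suzukiCoeff (k + 2) ≤ 0)]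
    ring

/-! ### The error of one time step -/

section LocalError

variable {A : Type*} [NormedRing A] [NormedAlgebra ℂ A] [CompleteSpace A] {m : ℕ}

theorem evolve_of_eq_smul {H : Fin m → A} {B : A} {d : Fin m → ℂ} (h : ∀ j, H j = d j • B)
    (L : Splitting m) (z : ℂ) :
    evolve H L z =
      NormedSpace.exp ((-(Complex.I * z * (L.map fun x => (x.2 : ℂ) * d x.1).sum)) • B) := by
  induction L with
  | nil => simp [evolve]
  | cons x L ih =>
    rw [evolve_cons, ih, h, smul_smul, ← exp_add_smul, List.map_cons, List.sum_cons]
    congr 2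
    ring

/-- Multiples of one operator commute, so only the total time given to each of them matters. -/
theorem evolve_suzuki_of_eq_smul {H : Fin m → A} {B : A} {d : Fin m → ℂ}
    (h : ∀ j, H j = d j • B) (k : ℕ) (z : ℂ) :
    evolve H (suzuki m (k + 1) 1) z = exactEvolution H z := by
  induction k generalizing z with
  | zero =>
    change evolve H (strang m 1) z = _
    rw [evolve_of_eq_smul h, exactEvolution, sum_map_strang, Finset.sum_congr rfl fun j _ => h j,
      ← Finset.sum_smul, smul_smul]
    congr 3
    rw [neg_mul]
    congr 2
    refine Finset.sum_congr rfl fun j _ => ?_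
    push_cast
    ring
  | succ k ih =>
    simp only [evolve_suzuki_add_two, ih, ← exactEvolution_add]
    congr 1
    ring

theorem exp_sub_exp_le (u v : ℝ) : Real.exp u - Real.exp v ≤ (u - v) * Real.exp u := by
  have h := Real.add_one_le_exp (v - u)
  have h1 : Real.exp v = Real.exp (v - u) * Real.exp u := by rw [← Real.exp_add]; ring_nf
  nlinarith [Real.exp_pos u]

variable [NormOneClass A]

theorem norm_evolve_suzuki_sub_le {H : Fin (m + 2) → A} {a b : ℝ} (h0 : ‖H 0‖ ≤ a)
    (hb : ∀ j, j ≠ 0 → ‖H j‖ ≤ b) (hb0 : 0 ≤ b) (hba : b ≤ a) (k : ℕ) (z : ℂ) :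
    ‖evolve H (suzuki (m + 2) (k + 1) 1) z - exactEvolution H z‖ ≤
      2 * (‖z‖ * suzukiGrowth k * ((m + 1) * b)) *
        Real.exp (‖z‖ * suzukiGrowth k * ((m + 2) * a)) := by
  -- The comparison system keeps only H 0; its majorant β differs from α by b in each of the other m
  -- + 1 places.
  set H' : Fin (m + 2) → A := fun j => (if j = 0 then (1 : ℂ) else 0) • H 0 with hH'
  set α : Fin (m + 2) → ℝ := fun j => if j = 0 then a else b with hα
  set β : Fin (m + 2) → ℝ := fun j => if j = 0 then a else 0 with hβ
  have hmaj : ∀ j, Majorizes (H j) (H' j) (α j) (β j) := by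
    intro j
    by_cases hj : j = 0
    · subst hj
      simp only [hH', hα, hβ, if_true, one_smul]
      exact ⟨h0, h0, by simp⟩
    · simp only [hH', hα, hβ, if_neg hj, zero_smul]
      exact ⟨hb j hj, by simp, by simpa using hb j hj⟩
  have hsα : ∑ j, α j = a + (m + 1) * b := by
    rw [Fin.sum_univ_succ]
    simp [hα, Fin.succ_ne_zero]
  have hsβ : ∑ j, β j = a := by
    simp [hβ]
  have h1 := (Majorizes.evolve hmaj (suzuki (m + 2) (k + 1) 1) z).sub
  have h2 := (Majorizes.exactEvolution hmaj z).sub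
  rw [evolve_suzuki_of_eq_smul (fun j => rfl)] at h1
  simp only [absWeight_suzuki, hsα, hsβ, abs_one, one_mul] at h1 h2
  have hz := norm_nonneg z
  have hD := one_le_suzukiGrowth k
  set D := suzukiGrowth k
  set r := ‖z‖
  have hm : (0 : ℝ) ≤ m := Nat.cast_nonneg m
  have hexp : ∀ x, 0 ≤ x → x ≤ r * D → Real.exp (x * (a + (m + 1) * b)) - Real.exp (x * a) ≤
      (r * D * ((m + 1) * b)) * Real.exp (r * D * ((m + 2) * a)) := by
    intro x hx hxr
    refine (exp_sub_exp_le _ _).trans ?_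
    have e1 : x * (a + (m + 1) * b) - x * a = x * ((m + 1) * b) := by ring
    rw [e1]
    have hmb : 0 ≤ ((m : ℝ) + 1) * b := by positivity
    have e2 : a + (m + 1) * b ≤ (m + 2) * a := by nlinarith
    exact mul_le_mul (mul_le_mul_of_nonneg_right hxr hmb)
      (Real.exp_le_exp.2 (mul_le_mul hxr e2 (by linarith) (by positivity)))
      (Real.exp_pos _).le (by positivity)
  have h3 := hexp (r * D) (by positivity) le_rfl
  have h4 := hexp r hz (le_mul_of_one_le_right hz hD)
  simp only [← mul_assoc r D] at h1
  -- Splitting and exact evolution coincide for H', so that common value can be subtracted from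
  -- both; this costs the factor 2.
  calc ‖evolve H (suzuki (m + 2) (k + 1) 1) z - exactEvolution H z‖
      = ‖(evolve H (suzuki (m + 2) (k + 1) 1) z - exactEvolution H' z) -
          (exactEvolution H z - exactEvolution H' z)‖ := by congr 1; abel
    _ ≤ _ := (norm_sub_le _ _).trans (add_le_add h1 h2)
    _ ≤ _ := by linarith

/-- The error of Suzuki's formula for one time step. -/
theorem norm_evolve_suzuki_sub_le_pow {H : Fin (m + 2) → A} {a b : ℝ} (h0 : ‖H 0‖ ≤ a)
    (hb : ∀ j, j ≠ 0 → ‖H j‖ ≤ b) (hb0 : 0 ≤ b) (hba : b ≤ a) (ha : 0 < a) (k : ℕ) (z : ℂ)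
    (hz : ‖z‖ * suzukiGrowth k * ((m + 2) * a) < 2 * (k + 1)) :
    ‖evolve H (suzuki (m + 2) (k + 1) 1) z - exactEvolution H z‖ ≤
      2 * (‖z‖ * suzukiGrowth k * ((m + 1) * b)) *
        (Real.exp 1 * (‖z‖ * suzukiGrowth k * ((m + 2) * a)) / (2 * (k + 1))) ^ (2 * k + 2) := by
  obtain ⟨c, hc⟩ := agreesTo_suzuki H k
  have hD := one_le_suzukiGrowth k
  have hD0 : 0 < suzukiGrowth k := by linarith
  set D := suzukiGrowth k
  set f : ℂ → A := fun w => evolve H (suzuki (m + 2) (k + 1) 1) w - exactEvolution H w with hf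
  -- With c = D(m+2)a, this radius minimises e^{Rc}/R^{2k+2}, the R-dependent part of the Schwarz
  -- bound.
  set R : ℝ := 2 * (k + 1) / (D * ((m + 2) * a)) with hR
  have hRpos : 0 < R := by positivity
  have hfd : Differentiable ℂ f :=
    (differentiable_evolve H _).sub (differentiable_exactEvolution H)
  have hf0 : f 0 = 0 := by simp [hf, evolve_zero, exactEvolution_zero]
  have hRD : R * D * ((m + 2) * a) = 2 * (k + 1) := by
    rw [hR]; field_simp
  have hmaps : Set.MapsTo f (Metric.ball 0 R) (Metric.closedBall (f 0)
      (2 * (R * D * ((m + 1) * b)) * Real.exp (2 * (k + 1)))) := by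
    intro w hw
    rw [mem_ball_zero_iff] at hw
    rw [hf0, mem_closedBall_zero_iff]
    refine (norm_evolve_suzuki_sub_le h0 hb hb0 hba k w).trans ?_
    rw [← hRD]
    change 2 * (‖w‖ * D * ((m + 1) * b)) * Real.exp (‖w‖ * D * ((m + 2) * a)) ≤ _
    gcongr
  have hz' : z ∈ Metric.ball (0 : ℂ) R := by
    rw [mem_ball_zero_iff, hR, lt_div_iff₀ (by positivity), ← mul_assoc]
    exact hz
  have hO : (fun w => f w - f 0) =o[𝓝 0] fun w : ℂ => ‖w - 0‖ ^ (2 * k + 2) := by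
    simpa [hf0] using hc.sub.isLittleO
  -- This gives the power 2k+3 of ‖z‖/R; one of these factors absorbs the R in the bound on the disc
  -- and leaves ‖z‖.
  have hS := Complex.dist_le_mul_div_pow_of_mapsTo_ball_of_isLittleO hfd.differentiableOn hmaps hO hz'
  rw [hf0, dist_zero_right, dist_zero_right] at hS
  refine hS.trans_eq ?_
  have he : Real.exp (2 * (k + 1)) = Real.exp 1 ^ (2 * k + 2) := by
    rw [← Real.exp_nat_mul]
    push_cast
    congr 1
    ring
  have hzR : ‖z‖ = ‖z‖ / R * R := by field_simp
  have hx : ‖z‖ * D * ((m + 2) * a) / (2 * (k + 1)) = ‖z‖ / R := by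
    rw [hR]; field_simp
  rw [mul_div_assoc, hx, mul_pow, he, pow_succ (‖z‖ / R)]
  field_simp

end LocalError

/-! ### Counting exponentials after merging -/

section Merge

variable {m : ℕ}

theorem Splitting.length_consMerge_le (x : Fin m × ℝ) (L : Splitting m) :
    (Splitting.consMerge x L).length ≤ L.length + 1 := by
  cases L with
  | nil => simp [Splitting.consMerge]
  | cons y L =>
    simp only [Splitting.consMerge]
    split <;> simp

theorem Splitting.merge_cons (x : Fin m × ℝ) (L : Splitting m) :
    Splitting.merge (x :: L) = Splitting.consMerge x L.merge := rfl

theorem Splitting.length_merge_append_le (L L' : Splitting m) :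
    (Splitting.merge (L ++ L')).length ≤ L.length + L'.merge.length := by
  induction L with
  | nil => simp
  | cons x L ih =>
    rw [List.cons_append, Splitting.merge_cons, List.length_cons]
    have := Splitting.length_consMerge_le x (Splitting.merge (L ++ L'))
    omega

theorem Splitting.length_consMerge_consMerge_le {x y : Fin m × ℝ} (h : x.1 = y.1)
    (L : Splitting m) :
    (Splitting.consMerge x (Splitting.consMerge y L)).length ≤ L.length + 1 := by
  cases L with
  | nil => simp [Splitting.consMerge, h]
  | cons w L =>
    by_cases hw : y.1 = w.1
    · simp [Splitting.consMerge, h, hw]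
    · simp [Splitting.consMerge, h, hw]

/-- The two middle exponentials share the last Hamiltonian and merge, leaving 2(m+1) - 1. Savings at
the junctions between blocks are not needed. -/
theorem length_merge_strang_append_le (m : ℕ) (Δ : ℝ) (L : Splitting (m + 1)) :
    (Splitting.merge (strang (m + 1) Δ ++ L)).length ≤ (2 * m + 1) + L.merge.length := by
  obtain ⟨X, Y, x, hX, hY, h⟩ : ∃ (X Y : Splitting (m + 1)) (x : Fin (m + 1) × ℝ),
      X.length = m ∧ Y.length = m ∧ strang (m + 1) Δ = X ++ (x :: x :: Y) := by
    refine ⟨((List.finRange m).map Fin.castSucc).map fun j => (j, Δ / 2),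
      ((List.finRange m).map Fin.castSucc).reverse.map fun j => (j, Δ / 2),
      (Fin.last m, Δ / 2), by simp, by simp, ?_⟩
    rw [strang, List.finRange_succ_last]
    simp
  rw [h, List.append_assoc]
  refine (Splitting.length_merge_append_le _ _).trans ?_
  have h1 := Splitting.length_consMerge_consMerge_le (rfl : x.1 = x.1) (Splitting.merge (Y ++ L))
  have h2 := Splitting.length_merge_append_le Y L
  rw [List.cons_append, List.cons_append, Splitting.merge_cons, Splitting.merge_cons]
  omega

/-- Merging proceeds from the right, so an arbitrary tail L lets the bound be applied to the five
blocks in turn. -/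
theorem length_merge_suzuki_append_le (m k : ℕ) (Δ : ℝ) (L : Splitting (m + 1)) :
    (Splitting.merge (suzuki (m + 1) (k + 1) Δ ++ L)).length ≤
      5 ^ k * (2 * m + 1) + L.merge.length := by
  induction k generalizing Δ L with
  | zero =>
    rw [pow_zero, one_mul]
    exact length_merge_strang_append_le m Δ L
  | succ k ih =>
    rw [suzuki_add_two]
    simp only [List.append_assoc]
    refine (ih _ _).trans ?_
    refine (Nat.add_le_add_left (ih _ _) _).trans ?_
    refine (Nat.add_le_add_left (Nat.add_le_add_left (ih _ _) _) _).trans ?_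
    refine (Nat.add_le_add_left (Nat.add_le_add_left (Nat.add_le_add_left (ih _ _) _) _) _).trans ?_
    refine (Nat.add_le_add_left (Nat.add_le_add_left (Nat.add_le_add_left
      (Nat.add_le_add_left (ih _ _) _) _) _) _).trans ?_
    rw [pow_succ]
    linarith

theorem length_splittingMethod_le (m k n : ℕ) (t : ℝ) :
    (splittingMethod (m + 1) (k + 1) n t).length ≤ n * (5 ^ k * (2 * m + 1)) := by
  rw [splittingMethod]
  generalize t / (n : ℝ) = Δ
  induction n with
  | zero => simp [Splitting.merge]
  | succ n ih =>
    rw [List.replicate_succ, List.flatten_cons]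
    refine (length_merge_suzuki_append_le m k Δ _).trans ?_
    linarith

end Merge

/-! ### From splittings to operators, and unitarity at real times -/

section Operator

variable {E : Type*} [NormedAddCommGroup E] [InnerProductSpace ℂ E] {m : ℕ}

theorem Splitting.toOperator_eq_evolve (H : Fin m → E →L[ℂ] E) (L : Splitting m) :
    L.toOperator H = evolve H L 1 := by
  simp [Splitting.toOperator, evolve]

theorem toOperator_suzuki (H : Fin m → E →L[ℂ] E) (k : ℕ) (Δ : ℝ) :
    (suzuki m (k + 1) Δ).toOperator H = evolve H (suzuki m (k + 1) 1) Δ := by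
  rw [Splitting.toOperator_eq_evolve, suzuki_eq_scale, evolve_scale, mul_one]

variable [CompleteSpace E]

theorem Splitting.toOperator_consMerge (H : Fin m → E →L[ℂ] E) (x : Fin m × ℝ)
    (L : Splitting m) : (Splitting.consMerge x L).toOperator H = Splitting.toOperator H (x :: L) := by
  cases L with
  | nil => rfl
  | cons y L =>
    by_cases h : x.1 = y.1
    · have h1 : Splitting.consMerge x (y :: L) = (x.1, x.2 + y.2) :: L := by
        simp [Splitting.consMerge, h]
      rw [h1, Splitting.toOperator_eq_evolve, Splitting.toOperator_eq_evolve, evolve_cons,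
        evolve_cons, evolve_cons, ← h,
        ← mul_assoc (NormedSpace.exp _) (NormedSpace.exp _), ← exp_add_smul]
      congr 3
      push_cast
      ring
    · simp [Splitting.consMerge, h]

theorem Splitting.toOperator_merge (H : Fin m → E →L[ℂ] E) (L : Splitting m) :
    L.merge.toOperator H = L.toOperator H := by
  induction L with
  | nil => rfl
  | cons x L ih =>
    rw [Splitting.merge_cons, Splitting.toOperator_consMerge, Splitting.toOperator_eq_evolve,
      Splitting.toOperator_eq_evolve, evolve_cons, evolve_cons, ← Splitting.toOperator_eq_evolve,
      ← Splitting.toOperator_eq_evolve, ih]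

theorem toOperator_splittingMethod (H : Fin m → E →L[ℂ] E) (k n : ℕ) (t : ℝ) :
    (splittingMethod m (k + 1) n t).toOperator H =
      evolve H (suzuki m (k + 1) 1) ((t / n : ℝ) : ℂ) ^ n := by
  rw [splittingMethod, Splitting.toOperator_merge, ← toOperator_suzuki]
  generalize suzuki m (k + 1) (t / (n : ℝ)) = L
  induction n with
  | zero => simp [Splitting.toOperator]
  | succ n ih =>
    rw [List.replicate_succ, List.flatten_cons, pow_succ', ← ih]
    simp only [Splitting.toOperator_eq_evolve, evolve_append]

theorem exactEvolution_div_pow (H : Fin m → E →L[ℂ] E) (z : ℂ) {n : ℕ} (hn : n ≠ 0) :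
    exactEvolution H (z / n) ^ n = exactEvolution H z := by
  have h : ∀ (w : ℂ) (l : ℕ), exactEvolution H w ^ l = exactEvolution H (l * w) := by
    intro w l
    induction l with
    | zero => simp [exactEvolution_zero]
    | succ l ih =>
      rw [pow_succ, ih, ← exactEvolution_add]
      congr 1
      push_cast
      ring
  rw [h, mul_div_cancel₀ z (Nat.cast_ne_zero.2 hn)]

theorem norm_exp_le_one {B : E →L[ℂ] E} (hB : IsSelfAdjoint B) (τ : ℝ) :
    ‖NormedSpace.exp ((-(Complex.I * (τ : ℂ))) • B)‖ ≤ 1 := by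
  let _ := NormedAlgebra.restrictScalars ℚ ℂ (E →L[ℂ] E)
  have h : (-(Complex.I * (τ : ℂ))) • B ∈ skewAdjoint (E →L[ℂ] E) := by
    rw [skewAdjoint.mem_iff, star_smul, hB.star_eq, ← neg_smul]
    congr 1
    simp
  rcases subsingleton_or_nontrivial (E →L[ℂ] E) with hE | hE
  · rw [Subsingleton.elim (NormedSpace.exp _) (0 : E →L[ℂ] E), norm_zero]
    exact zero_le_one
  exact (CStarRing.norm_of_mem_unitary (NormedSpace.exp_mem_unitary_of_mem_skewAdjoint h)).le

theorem norm_evolve_le_one {H : Fin m → E →L[ℂ] E} (hH : ∀ j, IsSelfAdjoint (H j))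
    (L : Splitting m) (τ : ℝ) : ‖evolve H L τ‖ ≤ 1 := by
  induction L with
  | nil => exact ContinuousLinearMap.norm_id_le
  | cons x L ih =>
    rw [evolve_cons, ← Complex.ofReal_mul]
    exact (norm_mul_le _ _).trans
      (mul_le_one₀ (norm_exp_le_one (hH x.1) _) (norm_nonneg _) ih)

theorem norm_exactEvolution_le_one {H : Fin m → E →L[ℂ] E} (hH : ∀ j, IsSelfAdjoint (H j))
    (τ : ℝ) : ‖exactEvolution H τ‖ ≤ 1 :=
  norm_exp_le_one (isSelfAdjoint_sum _ fun j _ => hH j) τ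

end Operator

theorem norm_pow_sub_pow_le {A : Type*} [NormedRing A] {a b : A}
    (ha : ‖a‖ ≤ 1) (hb : ‖b‖ ≤ 1) (n : ℕ) : ‖a ^ n - b ^ n‖ ≤ n * ‖a - b‖ := by
  induction n with
  | zero => simp
  | succ n ih =>
    -- The ring need not satisfy ‖1‖ ≤ 1, so the power 0 is treated apart.
    rcases Nat.eq_zero_or_pos n with rfl | hn
    · simp
    have hbn : ‖b ^ n‖ ≤ 1 := (norm_pow_le' b hn).trans (pow_le_one₀ (norm_nonneg b) hb)
    calc ‖a ^ (n + 1) - b ^ (n + 1)‖ = ‖(a ^ n - b ^ n) * a + b ^ n * (a - b)‖ := by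
          rw [pow_succ, pow_succ]
          congr 1
          noncomm_ring
      _ ≤ ‖a ^ n - b ^ n‖ * ‖a‖ + ‖b ^ n‖ * ‖a - b‖ :=
        (norm_add_le _ _).trans (add_le_add (norm_mul_le _ _) (norm_mul_le _ _))
      _ ≤ n * ‖a - b‖ * 1 + 1 * ‖a - b‖ :=
        add_le_add (mul_le_mul ih ha (norm_nonneg _) (by positivity))
          (mul_le_mul_of_nonneg_right hbn (norm_nonneg _))
      _ = (n + 1 : ℕ) * ‖a - b‖ := by push_cast; ring

/-! ### Numerical inequalities for the number of steps -/

section Arithmetic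

/-- The number of time steps is at least one under either condition of the theorem. -/
theorem one_le_steps {q Y : ℝ} (hq : 0 < q) (hY : 1 ≤ Y)
    (h : 3 ≤ q ∨ Real.log (q / 5) ^ 2 - 2 * Real.log (5 / 3) * Real.log Y < 0) (k : ℕ) :
    1 ≤ q / 3 * Y ^ (1 / (2 * ((k : ℝ) + 1))) * (5 / 3) ^ k := by
  have hY0 : 0 < Y := by linarith
  rcases h with h | h
  · have h1 : 1 ≤ Y ^ (1 / (2 * ((k : ℝ) + 1))) := Real.one_le_rpow hY (by positivity)
    have h2 : (1 : ℝ) ≤ (5 / 3) ^ k := one_le_pow₀ (by norm_num)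
    exact one_le_mul_of_one_le_of_one_le
      (one_le_mul_of_one_le_of_one_le (by linarith) h1) h2
  · have hc : 0 < Real.log (5 / 3) := Real.log_pos (by norm_num)
    have hl : 0 ≤ Real.log Y := Real.log_nonneg hY
    have hs0 : 0 ≤ ((k : ℝ) + 1) * Real.log (5 / 3) + Real.log Y / (2 * ((k : ℝ) + 1)) := by
      positivity
    -- AM-GM: with A = (k+1) log(5/3) and B = log Y/(2(k+1)), (A+B)² ≥ 4AB = 2 log(5/3) log Y,
    -- independently of k. The logarithm of the number of steps is log(q/5) + A + B, hence positive.
    have hs : Real.log (q / 5) ^ 2 <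
        (((k : ℝ) + 1) * Real.log (5 / 3) + Real.log Y / (2 * ((k : ℝ) + 1))) ^ 2 := by
      have h1 : ((k : ℝ) + 1) * Real.log (5 / 3) * (Real.log Y / (2 * ((k : ℝ) + 1))) =
          Real.log (5 / 3) * Real.log Y / 2 := by
        field_simp
      nlinarith [sq_nonneg (((k : ℝ) + 1) * Real.log (5 / 3) - Real.log Y / (2 * ((k : ℝ) + 1)))]
    have h2 := (abs_lt.1 (abs_lt_of_sq_lt_sq hs hs0)).1
    have h3 : q / 3 = q / 5 * (5 / 3) := by ring
    rw [← Real.log_nonneg_iff (by positivity), Real.log_mul (by positivity) (by positivity),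
      Real.log_mul (by positivity) (by positivity), Real.log_rpow hY0, Real.log_pow, h3,
      Real.log_mul (by positivity) (by norm_num)]
    have h4 : 1 / (2 * ((k : ℝ) + 1)) * Real.log Y = Real.log Y / (2 * ((k : ℝ) + 1)) := by ring
    rw [h4]
    linarith

/-- The constant 3/8 from the step size absorbs the growth of the absolute times: 2 · (5/3) · (3/8)²
= 15/32 < 1. -/
theorem succ_mul_pow_mul_pow_le_one (k : ℕ) :
    ((k : ℝ) + 1) * (5 / 3) ^ k * (3 / 8) ^ (2 * k + 2) ≤ 1 := by
  have h1 : ((k : ℝ) + 1) ≤ 2 ^ k := by exact_mod_cast Nat.lt_two_pow_self (n := k)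
  calc ((k : ℝ) + 1) * (5 / 3) ^ k * (3 / 8) ^ (2 * k + 2)
      ≤ 2 ^ k * (5 / 3) ^ k * (3 / 8) ^ (2 * k + 2) := by gcongr
    _ = (15 / 32) ^ k * (9 / 64) := by
      rw [pow_add, pow_mul, ← mul_assoc, ← mul_pow, ← mul_pow]
      norm_num
    _ ≤ 1 * 1 := by
      gcongr
      · exact pow_le_one₀ (by norm_num) (by norm_num)
      · norm_num
    _ = 1 := one_mul 1

end Arithmetic

/-! ### The global error and the final count -/

/-- The accuracy of `n` steps of Suzuki's formula, for `n` large enough. -/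
theorem norm_exp_sub_splittingMethod_le {E : Type*} [NormedAddCommGroup E] [InnerProductSpace ℂ E]
    [CompleteSpace E] [Nontrivial E] {m : ℕ} {H : Fin (m + 2) → E →L[ℂ] E}
    (hH : ∀ j, IsSelfAdjoint (H j)) {a b : ℝ} (h0 : ‖H 0‖ ≤ a)
    (hb : ∀ j, j ≠ 0 → ‖H j‖ ≤ b) (hb0 : 0 < b) (hba : b ≤ a) {t ε : ℝ} (ht : 0 < t)
    (hε0 : 0 < ε) {k n : ℕ} (hn0 : n ≠ 0)
    (hY : 1 ≤ 4 * (m + 2) * Real.exp 1 * t * b / ε)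
    (hn : 4 * (m + 2) * Real.exp 1 * t * a / 3 *
      (4 * (m + 2) * Real.exp 1 * t * b / ε) ^ (1 / (2 * ((k : ℝ) + 1))) * (5 / 3) ^ k ≤ n) :
    ‖NormedSpace.exp ((-(Complex.I * (t : ℂ))) • ∑ j, H j) -
      (splittingMethod (m + 2) (k + 1) n t).toOperator H‖ ≤ ε := by
  have hnpos : (0 : ℝ) < n := by positivity
  have ha : 0 < a := hb0.trans_le hba
  set Y := 4 * (m + 2) * Real.exp 1 * t * b / ε with hYdef
  have hY0 : 0 < Y := by linarith
  set w := Y ^ (1 / (2 * ((k : ℝ) + 1))) with hw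
  have hw1 : 1 ≤ w := Real.one_le_rpow hY (by positivity)
  have hwY : w ^ (2 * k + 2) = Y := by
    rw [hw, ← Real.rpow_natCast, ← Real.rpow_mul hY0.le]
    push_cast
    rw [show 1 / (2 * ((k : ℝ) + 1)) * (2 * k + 2) = 1 by field_simp, Real.rpow_one]
  have hD1 := one_le_suzukiGrowth k
  have hD := suzukiGrowth_le k
  set D := suzukiGrowth k
  have hDpos : 0 < D := by linarith
  have he1 : 1 ≤ Real.exp 1 := Real.one_le_exp zero_le_one
  have hepos : 0 < Real.exp 1 := Real.exp_pos 1
  set x := t / n * D * ((m + 2) * a) with hx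
  have hx0 : 0 ≤ x := by positivity
  -- The k + 1 and (5/3)^k in the bound on D cancel against 2(k+1) and the lower bound on n. The
  -- (2k+2)-th power then supplies 1/Y, which is proportional to ε.
  have hex : Real.exp 1 * x / (2 * (k + 1)) ≤ 3 / 8 / w := by
    rw [div_div, div_le_div_iff₀ (by positivity) (by positivity)]
    have h1 : x * n = D * ((m + 2) * a * t) := by rw [hx]; field_simp
    have h2 : x * (4 * (m + 2) * Real.exp 1 * t * a / 3 * w * (5 / 3) ^ k) ≤ x * n :=
      mul_le_mul_of_nonneg_left hn hx0
    have h3 : D * ((m + 2) * a * t) ≤ ((k + 1) * (5 / 3) ^ k) * ((m + 2) * a * t) :=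
      mul_le_mul_of_nonneg_right hD (by positivity)
    have h4 : ((m + 2) * a * t * (5 / 3) ^ k) * (x * (4 * Real.exp 1 / 3 * w)) ≤
        ((m + 2) * a * t * (5 / 3) ^ k) * (k + 1) := by linarith
    have h5 := le_of_mul_le_mul_left h4 (by positivity)
    linarith
  have hex1 : Real.exp 1 * x / (2 * (k + 1)) < 1 := by
    have : 3 / 8 / w ≤ 3 / 8 := div_le_self (by norm_num) hw1
    linarith
  have hxlt : x < 2 * (k + 1) := by
    rw [div_lt_one (by positivity)] at hex1
    exact (le_mul_of_one_le_left hx0 he1).trans_lt hex1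
  have hz : ‖((t / n : ℝ) : ℂ)‖ = t / n := by
    rw [Complex.norm_real, Real.norm_of_nonneg (by positivity)]
  have hloc := norm_evolve_suzuki_sub_le_pow h0 hb hb0.le hba ha k ((t / n : ℝ) : ℂ)
    (by rw [hz]; exact hxlt)
  rw [hz] at hloc
  have hexact : NormedSpace.exp ((-(Complex.I * (t : ℂ))) • ∑ j, H j) =
      exactEvolution H ((t / n : ℝ) : ℂ) ^ n := by
    push_cast
    rw [exactEvolution_div_pow H _ hn0]
    rfl
  rw [hexact, toOperator_splittingMethod, norm_sub_rev]
  refine (norm_pow_sub_pow_le (norm_evolve_le_one hH _ _) (norm_exactEvolution_le_one hH _) n).trans ?_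
  have hm : (0 : ℝ) ≤ m := Nat.cast_nonneg m
  have hpow : (Real.exp 1 * x / (2 * (k + 1))) ^ (2 * k + 2) ≤ (3 / 8) ^ (2 * k + 2) / Y := by
    rw [← hwY, ← div_pow]
    exact pow_le_pow_left₀ (by positivity) hex _
  have hDk : D * (3 / 8) ^ (2 * k + 2) ≤ 1 :=
    (mul_le_mul_of_nonneg_right hD (by positivity)).trans (succ_mul_pow_mul_pow_le_one k)
  calc (n : ℝ) * ‖evolve H (suzuki (m + 2) (k + 1) 1) ((t / n : ℝ) : ℂ) -
        exactEvolution H ((t / n : ℝ) : ℂ)‖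
      ≤ n * (2 * (t / n * D * ((m + 1) * b)) * ((3 / 8) ^ (2 * k + 2) / Y)) := by
        refine mul_le_mul_of_nonneg_left (hloc.trans ?_) hnpos.le
        exact mul_le_mul_of_nonneg_left hpow (by positivity)
    _ = D * (3 / 8) ^ (2 * k + 2) * ((m + 1) / ((m + 2) * (2 * Real.exp 1))) * ε := by
        rw [hYdef]
        field_simp
        norm_num
    _ ≤ 1 * 1 * ε := by
        refine mul_le_mul_of_nonneg_right (mul_le_mul hDk ?_ (by positivity) zero_le_one) hε0.le
        rw [div_le_one (by positivity)]
        nlinarith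
    _ = ε := by ring

end HamiltonianSimulation

theorem corollary1 {E : Type*} [NormedAddCommGroup E] [InnerProductSpace ℂ E] [CompleteSpace E]
    (m : ℕ) (hm : 2 ≤ m) (H : Fin m → E →L[ℂ] E)
    (hH : ∀ j, IsSelfAdjoint (H j))
    (hnorm : Antitone fun j => ‖H j‖)
    (h₁ h₂ : ℝ) (hh₁ : h₁ = ‖H ⟨0, by omega⟩‖) (hh₂ : h₂ = ‖H ⟨1, by omega⟩‖)
    (t ε : ℝ) (hε0 : 0 < ε) (hε1 : ε ≤ 1)
    (hε : ε ≤ 4 * m * Real.exp 1 * t * h₂)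
    (hcase : 3 ≤ 4 * m * Real.exp 1 * t * h₁ ∨
      Real.log (4 * m * Real.exp 1 * t * h₁ / 5) ^ 2 -
        2 * Real.log (5 / 3) * Real.log (4 * m * Real.exp 1 * t * h₂ / ε) < 0) :
    ∀ k : ℕ, 1 ≤ k → ∃ N : ℕ, HamiltonianSimulation.IsNumExponentials H t ε k N ∧
      (N : ℝ) ≤ 2 * (2 * (m : ℝ) - 1) * 5 ^ (k - 1) * h₁ * t *
        (4 * Real.exp 1 * m * t * h₂ / ε) ^ (1 / (2 * (k : ℝ))) *
        (4 * m * Real.exp 1 / 3) * (5 / 3) ^ (k - 1) := by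
  intro k hk
  obtain ⟨m, rfl⟩ : ∃ l, m = l + 2 := ⟨m - 2, by omega⟩
  obtain ⟨k, rfl⟩ : ∃ l, k = l + 1 := ⟨k - 1, by omega⟩
  have h2nn : 0 ≤ h₂ := by rw [hh₂]; exact norm_nonneg _
  have hepos : 0 < Real.exp 1 := Real.exp_pos 1
  have hmpos : (0 : ℝ) < ((m + 2 : ℕ) : ℝ) := by positivity
  have hprod : 0 < 4 * ((m + 2 : ℕ) : ℝ) * Real.exp 1 * t * h₂ := hε0.trans_le hε
  have h2pos : 0 < h₂ := by
    refine lt_of_le_of_ne h2nn fun h => ?_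
    rw [← h, mul_zero] at hprod
    exact lt_irrefl _ hprod
  have ht : 0 < t :=
    pos_of_mul_pos_right (pos_of_mul_pos_left hprod h2nn) (by positivity)
  have h21 : h₂ ≤ h₁ := by
    rw [hh₁, hh₂]
    exact hnorm (Fin.mk_le_mk.2 zero_le_one)
  have h1pos : 0 < h₁ := h2pos.trans_le h21
  -- Needed for ‖1‖ = 1, which the majorant estimates use.
  have : Nontrivial E := by
    by_contra hE
    rw [not_nontrivial_iff_subsingleton] at hE
    rw [hh₂, Subsingleton.elim (H ⟨1, by omega⟩) 0, norm_zero] at h2pos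
    exact lt_irrefl _ h2pos
  have hb : ∀ j : Fin (m + 2), j ≠ 0 → ‖H j‖ ≤ h₂ := by
    intro j hj
    rw [hh₂]
    refine hnorm (Fin.mk_le_of_le_val ?_)
    exact Nat.one_le_iff_ne_zero.2 fun h => hj (Fin.ext h)
  have hY : 1 ≤ 4 * ((m + 2 : ℕ) : ℝ) * Real.exp 1 * t * h₂ / ε := by
    rwa [one_le_div hε0]
  have hM1 := HamiltonianSimulation.one_le_steps
    (q := 4 * ((m + 2 : ℕ) : ℝ) * Real.exp 1 * t * h₁) (by positivity) hY hcase k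
  set M := 4 * ((m + 2 : ℕ) : ℝ) * Real.exp 1 * t * h₁ / 3 *
    (4 * ((m + 2 : ℕ) : ℝ) * Real.exp 1 * t * h₂ / ε) ^ (1 / (2 * ((k : ℝ) + 1))) *
      (5 / 3) ^ k with hM
  have hceil : M ≤ (⌈M⌉₊ : ℝ) := Nat.le_ceil M
  -- ⌈M⌉ < M + 1 ≤ 2M because M ≥ 1; this is the leading factor 2 of the final bound.
  have hceil2 : (⌈M⌉₊ : ℝ) ≤ 2 * M := by
    have := Nat.ceil_lt_add_one (by linarith : 0 ≤ M)
    linarith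
  have hn0 : ⌈M⌉₊ ≠ 0 := by
    intro h
    rw [h, Nat.cast_zero] at hceil
    linarith
  generalize ⌈M⌉₊ = n at hceil hceil2 hn0
  have hmem : (HamiltonianSimulation.splittingMethod (m + 2) (k + 1) n t).length ∈
      HamiltonianSimulation.achievableCounts H t ε (k + 1) := by
    refine ⟨n, Nat.one_le_iff_ne_zero.2 hn0, rfl, ?_⟩
    refine HamiltonianSimulation.norm_exp_sub_splittingMethod_le hH hh₁.ge hb h2pos h21 ht hε0
      hn0 (by exact_mod_cast hY) ?_
    rw [hM] at hceil
    exact_mod_cast hceil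
  classical
  have hex : ∃ N, N ∈ HamiltonianSimulation.achievableCounts H t ε (k + 1) := ⟨_, hmem⟩
  refine ⟨Nat.find hex, ⟨Nat.find_spec hex, fun N hN => Nat.find_min' hex hN⟩, ?_⟩
  have hlen := HamiltonianSimulation.length_splittingMethod_le (m + 1) k n t
  have h3 : ((Nat.find hex : ℕ) : ℝ) ≤ n * (5 ^ k * (2 * ((m : ℝ) + 1) + 1)) := by
    exact_mod_cast (Nat.find_min' hex hmem).trans hlen
  refine h3.trans ((mul_le_mul_of_nonneg_right hceil2 (by positivity)).trans_eq ?_)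
  rw [hM, Nat.add_sub_cancel, show 4 * Real.exp 1 * ((m + 2 : ℕ) : ℝ) * t * h₂ / ε =
    4 * ((m + 2 : ℕ) : ℝ) * Real.exp 1 * t * h₂ / ε by ring]
  rw [show (((k + 1 : ℕ) : ℝ)) = (k : ℝ) + 1 by push_cast; ring]
  generalize (4 * ((m + 2 : ℕ) : ℝ) * Real.exp 1 * t * h₂ / ε) ^ (1 / (2 * ((k : ℝ) + 1))) = w
  push_cast
  ring
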